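/- Let $p$ be an odd prime and let $G$ be a non-cyclic group of order $p^{\lambda}$ (so that $\lambda \geq 2$). Write $\mathfrak{s}(G)$ for the set of all subgroups of $G$ (including the trivial subgroup and $G$ itself). Then $|\mathfrak{s}(G)| \geq (p+1)(\lambda-1)+2$, with equality if and only if $$G \cong C_{p^{\lambda-1}} \times C_p \quad\text{or}\quad G \cong M_{p^{\lambda}} := \left\langle a, b \;\middle|\; a^{p^{\lambda-1}} = b^p = 1,\ a^b = a^{1+p^{\lambda-2}} \right\rangle,$$ where $C_n$ denotes the cyclic group of order $n$ and $a^b = b^{-1}ab$. -/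

import Mathlib

/-- The defining relators, in the free group on `a = of 0` and `b = of 1`, of the presentation
`⟨a, b ∣ a ^ p ^ (l - 1) = b ^ p = 1, a ^ b = a ^ (1 + p ^ (l - 2))⟩`,
where `a ^ b = b⁻¹ * a * b` denotes conjugation. It is meant for `2 ≤ l`. -/
def modularRels (p l : ℕ) : Set (FreeGroup (Fin 2)) :=
  {FreeGroup.of 0 ^ p ^ (l - 1),
   FreeGroup.of 1 ^ p,
   (FreeGroup.of 1)⁻¹ * FreeGroup.of 0 * FreeGroup.of 1 *
     (FreeGroup.of 0 ^ (1 + p ^ (l - 2)))⁻¹}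

/-- The group `M_{p^l}` given by the presentation with relators `modularRels p l`. -/
abbrev ModularGroup (p l : ℕ) : Type := PresentedGroup (modularRels p l)

/-- The cyclic group `C_n` of order `n` (for `n ≠ 0`), written multiplicatively. -/
abbrev CyclicGroup (n : ℕ) : Type := Multiplicative (ZMod n)

/-! Write |G| = p^(m+1). A non-cyclic G has at least p+1 subgroups of each order p, ..., p^m
(`succ_le_ncard_card_eq_pow`); with the trivial subgroup and G this is the bound. For order p^m it
is a covering count, and smaller orders follow by descending through non-cyclic maximal subgroups.

If no maximal subgroup is cyclic, order p^(m-1) is over-represented (`succ_lt_ncard_card_eq_pow`),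
so equality yields a cyclic ⟨a⟩ of index p. For odd p such a G splits as ⟨a⟩ ⋊ ⟨b⟩
(`exists_isSplitMetacyclic`). Every split group attains the bound, since its subgroups can be listed
(`IsSplitMetacyclic.subgroup_eq`), and the exponent r in a^b = a^r decides between the two
isomorphism types. -/

open Finset in
theorem exists_geom_sum_eq_mul_of_dvd_sub_one {p : ℕ} (hodd : Odd p) {r : ℤ}
    (hr : (p : ℤ) ∣ r - 1) :
    ∃ u : ℤ, ∑ i ∈ range p, r ^ i = p * u ∧ IsCoprime (p : ℤ) u := by
  obtain ⟨t, ht⟩ := hr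
  -- With r = 1 + pt the sum is p + pt·p(p-1)/2 modulo p², hence p modulo p² because p is odd.
  obtain ⟨c, hc⟩ := odd_sq_dvd_geom_sum₂_sub (a := (1 : ℤ)) (b := t) hodd
  have hr : r = 1 + p * t := by linarith
  simp only [one_pow, mul_one] at hc
  rw [← hr] at hc
  refine ⟨1 + p * c, by linear_combination hc, -c, 1, by ring⟩

/-! ### Powers when b conjugates a to a^r. -/

section Conjugation

variable {G : Type*} [Group G] {a b : G} {r : ℤ}

theorem conj_zpow_of_conj_eq_zpow (h : b⁻¹ * a * b = a ^ r) (i : ℤ) :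
    b⁻¹ * a ^ i * b = a ^ (r * i) := by
  have := conj_zpow (i := i) (a := b⁻¹) (b := a)
  rw [inv_inv] at this
  rw [← this, h, zpow_mul]

theorem zpow_mul_of_conj_eq_zpow (h : b⁻¹ * a * b = a ^ r) (i : ℤ) :
    a ^ i * b = b * a ^ (r * i) := by
  rw [← conj_zpow_of_conj_eq_zpow h]; group

theorem pow_conj_eq_zpow (h : b⁻¹ * a * b = a ^ r) (n : ℕ) :
    (b ^ n)⁻¹ * a * b ^ n = a ^ r ^ n := by
  induction n with
  | zero => simp
  | succ n ih =>
    calc (b ^ (n + 1))⁻¹ * a * b ^ (n + 1) = b⁻¹ * ((b ^ n)⁻¹ * a * b ^ n) * b := by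
          rw [pow_succ]; group
      _ = _ := by rw [ih, conj_zpow_of_conj_eq_zpow h, pow_succ']

open Finset in
theorem mul_zpow_pow_of_conj_eq_zpow (h : b⁻¹ * a * b = a ^ r) (j : ℤ) (n : ℕ) :
    (b * a ^ j) ^ n = b ^ n * a ^ (j * ∑ i ∈ range n, r ^ i) := by
  induction n with
  | zero => simp
  | succ n ih =>
    rw [pow_succ, ih, geom_sum_succ, mul_assoc, ← mul_assoc _ b, zpow_mul_of_conj_eq_zpow h,
      pow_succ, mul_assoc b, ← zpow_add, mul_assoc]
    congr 3
    ring

theorem dvd_pow_sub_one_of_conj_eq_zpow {n k : ℕ} (ha : orderOf a = n)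
    (hab : Commute a (b ^ k)) (h : b⁻¹ * a * b = a ^ r) : (n : ℤ) ∣ r ^ k - 1 := by
  have h1 := pow_conj_eq_zpow h k
  rw [mul_assoc, hab.eq, inv_mul_cancel_left] at h1
  have h2 : a ^ (1 : ℤ) = a ^ r ^ k := by rw [← h1, zpow_one]
  rw [zpow_eq_zpow_iff_modEq, ha] at h2
  exact h2.dvd

theorem dvd_sub_one_of_conj_eq_zpow {p m : ℕ} (hp : p.Prime) (hm : m ≠ 0)
    (ha : orderOf a = p ^ m) (hab : Commute a (b ^ p)) (h : b⁻¹ * a * b = a ^ r) :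
    (p : ℤ) ∣ r - 1 := by
  have h1 : (p : ℤ) ∣ r ^ p - 1 :=
    (by exact_mod_cast dvd_pow_self p hm : (p : ℤ) ∣ (p ^ m : ℕ)).trans
      (dvd_pow_sub_one_of_conj_eq_zpow ha hab h)
  have := Fact.mk hp
  rw [← ZMod.intCast_zmod_eq_zero_iff_dvd] at h1 ⊢
  push_cast at h1 ⊢
  rwa [ZMod.pow_card] at h1

end Conjugation

/-! ### Splitting over a cyclic subgroup of index p. -/

section PrimeIndex

variable {G : Type*} [Group G] {p m : ℕ}

theorem Subgroup.normal_of_card_eq_prime_pow [Fact p.Prime] (hG : Nat.card G = p ^ (m + 1))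
    {A : Subgroup G} (hA : Nat.card A = p ^ m) : A.Normal ∧ A.index = p := by
  have hp := Fact.out (p := p.Prime)
  have hidx : A.index = p := by
    have := A.card_mul_index
    rw [hA, hG, pow_succ] at this
    exact Nat.eq_of_mul_eq_mul_left (pow_pos hp.pos m) this
  refine ⟨Subgroup.normal_of_index_eq_minFac_card ?_, hidx⟩
  rw [hidx, hG, hp.pow_minFac (Nat.succ_ne_zero m)]

theorem Subgroup.exists_eq_zpow_mul_of_notMem [Fact p.Prime] {A : Subgroup G} [A.Normal]
    (hA : A.index = p) {x : G} (hx : x ∉ A) (g : G) : ∃ n : ℤ, ∃ y ∈ A, g = x ^ n * y := by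
  have h1 : (x : G ⧸ A) ≠ 1 := by rwa [Ne, QuotientGroup.eq_one_iff]
  obtain ⟨n, hn⟩ := Subgroup.mem_zpowers_iff.1 (mem_zpowers_of_prime_card
    (A.index_eq_card.symm.trans hA) h1 (g' := (g : G ⧸ A)))
  refine ⟨n, (x ^ n)⁻¹ * g, ?_, by group⟩
  rw [← QuotientGroup.mk_zpow] at hn
  exact QuotientGroup.eq.1 hn

/-- `G` has order `p ^ (m + 1)` and is the semidirect product of the cyclic subgroup generated by
`a`, of order `p ^ m`, by the one generated by `b`, of order `p`, and `a` is raised to the power `r`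
under conjugation by `b`. -/
structure IsSplitMetacyclic (p m : ℕ) (a b : G) (r : ℤ) : Prop where
  card_eq : Nat.card G = p ^ (m + 1)
  orderOf_eq : orderOf a = p ^ m
  notMem : b ∉ Subgroup.zpowers a
  pow_eq : b ^ p = 1
  conj_eq : b⁻¹ * a * b = a ^ r

/-- For x outside ⟨a⟩ with x^p = a^c, one has (x a^j)^p = a^(c + jpu) with u prime to p. Once p ∣ c,
some j makes this trivial. -/
theorem exists_isSplitMetacyclic (hp : p.Prime) (hodd : Odd p) (hm : m ≠ 0)
    (hcard : Nat.card G = p ^ (m + 1)) (hG : ¬ IsCyclic G) {a : G} (ha : orderOf a = p ^ m) :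
    ∃ (b : G) (r : ℤ), IsSplitMetacyclic p m a b r := by
  have := Fact.mk hp
  have : Finite G := Nat.finite_of_card_ne_zero (by rw [hcard]; exact (pow_pos hp.pos _).ne')
  have hA : Nat.card (Subgroup.zpowers a) = p ^ m := by rw [Nat.card_zpowers, ha]
  obtain ⟨hnorm, hidx⟩ := Subgroup.normal_of_card_eq_prime_pow hcard hA
  obtain ⟨x, hx⟩ : ∃ x, x ∉ Subgroup.zpowers a := by
    by_contra! h
    exact hG ⟨a, h⟩
  have hxp : x ^ p ∈ Subgroup.zpowers a := by
    rw [← hidx]; exact Subgroup.pow_index_mem _ x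
  obtain ⟨c, hc⟩ := Subgroup.mem_zpowers_iff.1 hxp
  obtain ⟨r, hr⟩ := Subgroup.mem_zpowers_iff.1
    (hnorm.conj_mem' a (Subgroup.mem_zpowers a) x)
  have hcomm : Commute a (x ^ p) := by
    rw [← hc]; exact Commute.self_zpow a c
  obtain ⟨u, hu, hpu⟩ := exists_geom_sum_eq_mul_of_dvd_sub_one hodd
    (dvd_sub_one_of_conj_eq_zpow hp hm ha hcomm hr.symm)
  -- Otherwise a^c generates ⟨a⟩, and x generates G.
  have hpc : (p : ℤ) ∣ c := by
    by_contra hpc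
    have hco : IsCoprime c (orderOf a : ℤ) := by
      rw [ha]; push_cast
      exact (((Nat.prime_iff_prime_int.1 hp).coprime_iff_not_dvd).2 hpc).symm.pow_right
    have hax : a ∈ Subgroup.zpowers x := by
      have : a ∈ Subgroup.zpowers (x ^ p) := by
        rw [← hc, mem_zpowers_zpow_iff]
        exact Int.isCoprime_iff_gcd_eq_one.1 hco
      exact Subgroup.zpowers_le.2 (Subgroup.npow_mem_zpowers x p) this
    refine hG ⟨x, fun g => ?_⟩
    obtain ⟨n, y, hy, rfl⟩ := Subgroup.exists_eq_zpow_mul_of_notMem hidx hx g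
    exact mul_mem (Subgroup.zpow_mem_zpowers x n) (Subgroup.zpowers_le.2 hax hy)
  obtain ⟨d, rfl⟩ := hpc
  -- w inverts u modulo p^m, so j = -dw cancels c = pd.
  obtain ⟨v, w, hvw⟩ := hpu.pow_left (m := m)
  refine ⟨x * a ^ (-d * w), r, hcard, ha, fun h => hx ?_, ?_, ?_⟩
  · exact (Subgroup.mul_mem_cancel_right _ (Subgroup.zpow_mem_zpowers a _)).1 h
  · rw [mul_zpow_pow_of_conj_eq_zpow hr.symm, ← hc, ← zpow_add, ← orderOf_dvd_iff_zpow_eq_one, ha,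
      hu]
    push_cast
    exact ⟨p * d * v, by linear_combination (-p * d) * hvw⟩
  · calc (x * a ^ (-d * w))⁻¹ * a * (x * a ^ (-d * w))
        = (a ^ (-d * w))⁻¹ * (x⁻¹ * a * x) * a ^ (-d * w) := by
          rw [mul_inv_rev]; simp only [mul_assoc]
      _ = a ^ r := by rw [← hr]; group

end PrimeIndex

/-! ### Subgroups of a split metacyclic group. -/

theorem Subgroup.exists_eq_zpowers_pow_of_le_zpowers {G : Type*} [Group G] {p m : ℕ}
    (hp : p.Prime) {a : G} (ha : orderOf a = p ^ m) {K : Subgroup G}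
    (hK : K ≤ Subgroup.zpowers a) : ∃ i ≤ m, K = Subgroup.zpowers (a ^ p ^ i) := by
  obtain ⟨n, hn⟩ : ∃ n : ℕ, K = Subgroup.zpowers (a ^ n) := by
    obtain ⟨n, hn⟩ := (Subgroup.le_zpowers_iff a K).1 hK
    exact ⟨n, hn⟩
  obtain ⟨i, hi, hgcd⟩ := (Nat.dvd_prime_pow hp).1 (Nat.gcd_dvd_right n (p ^ m))
  refine ⟨i, hi, hn.trans (le_antisymm ?_ ?_)⟩
  · rw [Subgroup.zpowers_le]
    obtain ⟨c, hc⟩ : p ^ i ∣ n := hgcd ▸ Nat.gcd_dvd_left _ _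
    rw [hc, pow_mul]
    exact Subgroup.npow_mem_zpowers _ c
  · rw [Subgroup.zpowers_le, ← hgcd, ← zpow_natCast a (n.gcd _), Nat.gcd_eq_gcd_ab, zpow_add, zpow_mul,
      zpow_mul, zpow_natCast, zpow_natCast, ← ha, pow_orderOf_eq_one, one_zpow, mul_one]
    exact Subgroup.zpow_mem_zpowers _ _

namespace IsSplitMetacyclic

variable {G : Type*} [Group G] {p m : ℕ} {a b : G} {r : ℤ}

theorem exists_geom_sum_eq_mul (h : IsSplitMetacyclic p m a b r) (hp : p.Prime) (hodd : Odd p)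
    (hm : m ≠ 0) :
    ∃ u : ℤ, ∑ i ∈ Finset.range p, r ^ i = p * u ∧ IsCoprime (p : ℤ) u :=
  exists_geom_sum_eq_mul_of_dvd_sub_one hodd
    (dvd_sub_one_of_conj_eq_zpow hp hm h.orderOf_eq (by rw [h.pow_eq]; exact .one_right a) h.conj_eq)

theorem normal_zpowers (h : IsSplitMetacyclic p m a b r) (hp : p.Prime) :
    (Subgroup.zpowers a).Normal ∧ (Subgroup.zpowers a).index = p :=
  have := Fact.mk hp
  Subgroup.normal_of_card_eq_prime_pow h.card_eq (by rw [Nat.card_zpowers, h.orderOf_eq])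

theorem exists_eq_zpow_mul_zpow (h : IsSplitMetacyclic p m a b r) (hp : p.Prime) (g : G) :
    ∃ n i : ℤ, g = b ^ n * a ^ i := by
  have := Fact.mk hp
  obtain ⟨_, hidx⟩ := h.normal_zpowers hp
  obtain ⟨n, _, ⟨i, rfl⟩, hg⟩ := Subgroup.exists_eq_zpow_mul_of_notMem hidx h.notMem g
  exact ⟨n, i, hg⟩

/-- The classification of the subgroups of `G`. -/
theorem subgroup_eq (h : IsSplitMetacyclic p m a b r) (hp : p.Prime) (hodd : Odd p)
    (hm : m ≠ 0) (H : Subgroup G) :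
    H = ⊤ ∨ (∃ i ≤ m, H = Subgroup.zpowers (a ^ p ^ i)) ∨
      ∃ i < m, ∃ j < p, H = Subgroup.zpowers (a ^ p ^ (i + 1)) ⊔
        Subgroup.zpowers (b * a ^ (p ^ i * j)) := by
  have := Fact.mk hp
  obtain ⟨_, hidx⟩ := h.normal_zpowers hp
  by_cases hH : H ≤ Subgroup.zpowers a
  · exact .inr (.inl (Subgroup.exists_eq_zpowers_pow_of_le_zpowers hp h.orderOf_eq hH))
  obtain ⟨g, hgH, hga⟩ := SetLike.not_le_iff_exists.1 hH
  obtain ⟨n, y, ⟨k, rfl⟩, hb⟩ := Subgroup.exists_eq_zpow_mul_of_notMem hidx hga b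
  have hbk : b * a ^ (-k) ∈ H := by
    have : b * a ^ (-k) = g ^ n := by rw [hb]; simp
    rw [this]; exact zpow_mem hgH n
  obtain ⟨i, him, hi⟩ :=
    Subgroup.exists_eq_zpowers_pow_of_le_zpowers hp h.orderOf_eq (K := H ⊓ Subgroup.zpowers a)
      inf_le_right
  cases i with
  | zero =>
    left
    have haH : a ∈ H := by
      have : a ∈ H ⊓ Subgroup.zpowers a := by rw [hi]; simp
      exact this.1
    have hbH : b ∈ H := (H.mul_mem_cancel_right (zpow_mem haH (-k))).1 hbk
    rw [eq_top_iff]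
    intro g _
    obtain ⟨n, i, rfl⟩ := h.exists_eq_zpow_mul_zpow hp g
    exact mul_mem (zpow_mem hbH n) (zpow_mem haH i)
  | succ i =>
    refine .inr (.inr ⟨i, him, ?_⟩)
    obtain ⟨u, hu, hpu⟩ := h.exists_geom_sum_eq_mul hp hodd hm
    -- This power is a^(-kpu). Its lying in ⟨a^(p^(i+1))⟩ forces p^i ∣ k.
    have hpH : (b * a ^ (-k)) ^ p ∈ H ⊓ Subgroup.zpowers a := by
      refine ⟨pow_mem hbk p, ?_⟩
      rw [mul_zpow_pow_of_conj_eq_zpow h.conj_eq, h.pow_eq, one_mul]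
      exact Subgroup.zpow_mem_zpowers _ _
    rw [hi, mul_zpow_pow_of_conj_eq_zpow h.conj_eq, h.pow_eq, one_mul, hu] at hpH
    obtain ⟨c, hc⟩ := Subgroup.mem_zpowers_iff.1 hpH
    rw [← zpow_natCast, ← zpow_mul, zpow_eq_zpow_iff_modEq, h.orderOf_eq] at hc
    have hdvd : (p : ℤ) ^ i ∣ k := by
      have h1 : (p : ℤ) ^ (i + 1) ∣ -k * (p * u) - (p ^ (i + 1) : ℕ) * c :=
        dvd_trans (by push_cast; exact pow_dvd_pow _ him) hc.dvd
      push_cast at h1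
      rw [dvd_sub_left (dvd_mul_right _ _), show -k * (p * u) = p * (-(k * u)) by ring, pow_succ',
        mul_dvd_mul_iff_left (by exact_mod_cast hp.ne_zero), dvd_neg] at h1
      exact hpu.pow_left.dvd_of_dvd_mul_right h1
    obtain ⟨k, rfl⟩ := hdvd
    have hp0 : (p : ℤ) ≠ 0 := by exact_mod_cast hp.ne_zero
    obtain ⟨j, hj⟩ := Int.eq_ofNat_of_zero_le (Int.emod_nonneg (-k) hp0)
    have hjp : j < p := by
      have := Int.emod_lt_of_pos (-k) (by exact_mod_cast hp.pos : (0 : ℤ) < p)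
      omega
    have haH : a ^ p ^ (i + 1) ∈ H := by
      have : a ^ p ^ (i + 1) ∈ H ⊓ Subgroup.zpowers a := by rw [hi]; simp
      exact this.1
    -- Multiplying by powers of a^(p^(i+1)) ∈ H reduces -k to its residue j modulo p.
    have hbjH : b * a ^ (p ^ i * j) ∈ H := by
      have : b * a ^ (p ^ i * j) =
          b * a ^ (-((p : ℤ) ^ i * k)) * (a ^ p ^ (i + 1)) ^ (-(-k / p)) := by
        rw [← zpow_natCast, ← zpow_natCast, ← zpow_mul, mul_assoc, ← zpow_add]
        congr 2
        push_cast
        rw [← hj]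
        linear_combination (p : ℤ) ^ i * Int.emod_add_mul_ediv (-k) p
      rw [this]
      exact mul_mem hbk (zpow_mem haH _)
    refine ⟨j, hjp, le_antisymm (fun g hg => ?_) ?_⟩
    · have hnot : b * a ^ (p ^ i * j) ∉ Subgroup.zpowers a := fun hmem => h.notMem
        ((Subgroup.mul_mem_cancel_right _ (Subgroup.npow_mem_zpowers a _)).1 hmem)
      obtain ⟨n, y, hy, hgy⟩ := Subgroup.exists_eq_zpow_mul_of_notMem hidx hnot g
      have hyH : y ∈ H ⊓ Subgroup.zpowers a :=
        ⟨(H.mul_mem_cancel_left (zpow_mem hbjH n)).1 (hgy ▸ hg), hy⟩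
      rw [hi] at hyH
      rw [hgy]
      exact mul_mem (Subgroup.mem_sup_right (Subgroup.zpow_mem_zpowers _ n))
        (Subgroup.mem_sup_left hyH)
    · simp only [sup_le_iff, Subgroup.zpowers_le]
      exact ⟨haH, hbjH⟩

open Finset in
theorem card_subgroup_le (h : IsSplitMetacyclic p m a b r) (hp : p.Prime) (hodd : Odd p)
    (hm : m ≠ 0) : Nat.card (Subgroup G) ≤ (p + 1) * m + 2 := by
  classical
  let S : Finset (Subgroup G) :=
    {⊤} ∪ ((range (m + 1)).image (fun i => Subgroup.zpowers (a ^ p ^ i)) ∪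
      (range m ×ˢ range p).image (fun x => Subgroup.zpowers (a ^ p ^ (x.1 + 1)) ⊔
        Subgroup.zpowers (b * a ^ (p ^ x.1 * x.2))))
  have hS : (S : Set (Subgroup G)) = Set.univ := by
    refine Set.eq_univ_of_forall fun H => ?_
    rcases h.subgroup_eq hp hodd hm H with hH | ⟨i, hi, hH⟩ | ⟨i, hi, j, hj, hH⟩
    · simp [S, hH]
    · refine mem_union_right _ (mem_union_left _ (mem_image.2 ⟨i, ?_, hH.symm⟩))
      rw [mem_range]; omega
    · exact mem_union_right _ (mem_union_right _ (mem_image.2 ⟨(i, j), by simp [hi, hj], hH.symm⟩))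
  rw [← Set.ncard_univ, ← hS, Set.ncard_coe_finset]
  -- Repetitions in the list are harmless: only an upper bound is needed.
  calc #S ≤ 1 + ((m + 1) + m * p) := by
        refine (card_union_le _ _).trans (add_le_add (card_singleton _).le
          ((card_union_le _ _).trans (add_le_add ?_ ?_)))
        · exact card_image_le.trans (card_range _).le
        · exact card_image_le.trans (by rw [card_product, card_range, card_range])
    _ = (p + 1) * m + 2 := by ring

end IsSplitMetacyclic

/-! ### Counting subgroups of each order. -/

section LowerBound

variable {G : Type*} [Group G] {p : ℕ}

theorem Subgroup.ncard_le_and_card_eq (M : Subgroup G) (q : ℕ) :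
    {H : Subgroup G | H ≤ M ∧ Nat.card H = q}.ncard = {K : Subgroup M | Nat.card K = q}.ncard := by
  have : {H : Subgroup G | H ≤ M ∧ Nat.card H = q} =
      Subgroup.map M.subtype '' {K : Subgroup M | Nat.card K = q} := by
    ext H
    constructor
    · rintro ⟨hHM, hH⟩
      refine ⟨H.subgroupOf M, ?_, Subgroup.map_subgroupOf_eq_of_le hHM⟩
      rw [Set.mem_ofPred_eq, ← hH]
      exact Nat.card_congr (Subgroup.subgroupOfEquivOfLe hHM).toEquiv
    · rintro ⟨K, hK, rfl⟩
      exact ⟨Subgroup.map_subtype_le K, (Subgroup.card_map_of_injective M.subtype_injective).trans hK⟩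
  rw [this, Set.ncard_image_of_injective _ (Subgroup.map_injective M.subtype_injective)]

open Finset in
theorem Nat.card_le_of_forall_exists_mem_subgroup [Finite G] {q : ℕ} (S : Finset (Subgroup G))
    (hS : ∀ H ∈ S, Nat.card H = q) (hcover : ∀ g : G, ∃ H ∈ S, g ∈ H) :
    Nat.card G ≤ 1 + #S * (q - 1) := by
  classical
  have := Fintype.ofFinite G
  have h1 : (univ.erase (1 : G)) ⊆
      S.biUnion fun H => (univ.filter (· ∈ H)).erase 1 := by
    intro g hg
    obtain ⟨H, hH, hgH⟩ := hcover g
    simp only [mem_biUnion, mem_erase, mem_filter, mem_univ, true_and, and_true] at hg ⊢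
    exact ⟨H, hH, hg, hgH⟩
  have h2 := (card_le_card h1).trans (card_biUnion_le_card_mul S _ (q - 1) fun H hH => by
    rw [card_erase_of_mem (by simp [H.one_mem]), ← hS H hH, Nat.card_eq_fintype_card,
      Fintype.card_subtype])
  rw [card_erase_of_mem (mem_univ _), Finset.card_univ, ← Nat.card_eq_fintype_card (α := G)] at h2
  omega

/-- As G is not cyclic, its subgroups of order p^m cover it, but p of them cover at most 1 + p(p^m -
1) < p^(m+1) elements. -/
theorem succ_le_ncard_index_eq_prime [Fact p.Prime] {m : ℕ} (hm : m ≠ 0)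
    (hcard : Nat.card G = p ^ (m + 1)) (hG : ¬ IsCyclic G) :
    p + 1 ≤ {H : Subgroup G | Nat.card H = p ^ m}.ncard := by
  have hp := Fact.out (p := p.Prime)
  have : Finite G := Nat.finite_of_card_ne_zero (by rw [hcard]; exact (pow_pos hp.pos _).ne')
  have hfin := Set.toFinite {H : Subgroup G | Nat.card H = p ^ m}
  have hle := Nat.card_le_of_forall_exists_mem_subgroup (q := p ^ m) hfin.toFinset (by simp)
    (fun g => by
      obtain ⟨k, hk, hgk⟩ := (Nat.dvd_prime_pow hp).1
        (hcard ▸ Subgroup.card_subgroup_dvd_card (Subgroup.zpowers g))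
      have hkm : k ≤ m := by
        by_contra hlt
        obtain rfl : k = m + 1 := by omega
        exact hG (isCyclic_iff_exists_zpowers_eq_top.2 ⟨g, Subgroup.eq_top_of_card_eq _
          (hgk.trans hcard.symm)⟩)
      obtain ⟨K, hK, hgK⟩ := Sylow.exists_subgroup_card_pow_prime_le p
        (hcard ▸ pow_dvd_pow p (Nat.le_succ m)) _ hgk hkm
      exact ⟨K, by simpa using hK, hgK (Subgroup.mem_zpowers g)⟩)
  rw [← Set.ncard_eq_toFinset_card _ hfin, hcard, pow_succ] at hle
  by_contra! hlt
  have hq : 1 < p ^ m := Nat.one_lt_pow hm hp.one_lt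
  obtain ⟨q, hq'⟩ : ∃ q, p ^ m = q + 1 := ⟨p ^ m - 1, by omega⟩
  rw [hq'] at hle hq hlt
  have h1 := Nat.mul_le_mul_right q (Nat.le_of_lt_succ hlt)
  have := hp.two_le
  simp only [Nat.add_sub_cancel] at hle
  nlinarith

/-- Otherwise G splits over a cyclic maximal ⟨a⟩, and the complement generator b lies in a cyclic
maximal ⟨y⟩. Having order p < |⟨y⟩|, b is a power of y^p, which lies in ⟨a⟩: a contradiction. The
quaternion group shows that p must be odd. -/
theorem exists_not_isCyclic_card_eq (hp : p.Prime) (hodd : Odd p) {m : ℕ}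
    (hcard : Nat.card G = p ^ (m + 3)) (hG : ¬ IsCyclic G) :
    ∃ M : Subgroup G, Nat.card M = p ^ (m + 2) ∧ ¬ IsCyclic M := by
  have := Fact.mk hp
  have : Finite G := Nat.finite_of_card_ne_zero (by rw [hcard]; exact (pow_pos hp.pos _).ne')
  by_contra! hcyc
  have hdvd : p ^ (m + 2) ∣ Nat.card G := hcard ▸ pow_dvd_pow p (Nat.le_succ _)
  obtain ⟨A, hA⟩ := Sylow.exists_subgroup_card_pow_prime p hdvd
  obtain ⟨a, rfl⟩ := (Subgroup.isCyclic_iff_exists_zpowers_eq_top A).1 (hcyc A hA)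
  obtain ⟨b, r, h⟩ := exists_isSplitMetacyclic hp hodd (Nat.succ_ne_zero _) hcard hG
    ((Nat.card_zpowers a).symm.trans hA)
  have hb : Nat.card (Subgroup.zpowers b) = p ^ 1 := by
    rw [Nat.card_zpowers, pow_one]
    exact orderOf_eq_prime h.pow_eq fun h1 => h.notMem (h1 ▸ one_mem _)
  obtain ⟨M, hM, hbM⟩ := Sylow.exists_subgroup_card_pow_prime_le p hdvd _ hb (by omega)
  obtain ⟨y, rfl⟩ := (Subgroup.isCyclic_iff_exists_zpowers_eq_top M).1 (hcyc M hM)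
  obtain ⟨n, rfl⟩ := Subgroup.mem_zpowers_iff.1 (hbM (Subgroup.mem_zpowers b))
  have hn := h.pow_eq
  rw [← zpow_natCast, ← zpow_mul, ← orderOf_dvd_iff_zpow_eq_one, ← Nat.card_zpowers, hM] at hn
  push_cast at hn
  rw [pow_succ, mul_dvd_mul_iff_right (by exact_mod_cast hp.ne_zero)] at hn
  obtain ⟨c, rfl⟩ := (dvd_pow_self (p : ℤ) (Nat.succ_ne_zero m)).trans hn
  obtain ⟨_, hidx⟩ := h.normal_zpowers hp
  refine h.notMem ?_
  rw [zpow_mul, zpow_natCast]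
  refine zpow_mem ?_ c
  have := Subgroup.pow_index_mem (Subgroup.zpowers a) y
  rwa [hidx] at this

theorem succ_le_ncard_card_eq_pow (hp : p.Prime) (hodd : Odd p) (k n : ℕ) :
    ∀ {G : Type*} [Group G], Nat.card G = p ^ (k + n + 2) → ¬ IsCyclic G →
      p + 1 ≤ {H : Subgroup G | Nat.card H = p ^ (k + 1)}.ncard := by
  have := Fact.mk hp
  induction n with
  | zero => intro G _ hcard hG; exact succ_le_ncard_index_eq_prime (Nat.succ_ne_zero k) hcard hG
  | succ n ih =>
    intro G _ hcard hG
    have : Finite G := Nat.finite_of_card_ne_zero (by rw [hcard]; exact (pow_pos hp.pos _).ne')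
    obtain ⟨M, hM, hMc⟩ := exists_not_isCyclic_card_eq hp hodd (m := k + n) hcard hG
    refine (ih hM hMc).trans ?_
    rw [← Subgroup.ncard_le_and_card_eq]
    exact Set.ncard_le_ncard fun H hH => hH.2

/-- A maximal M already contains p+1 subgroups of this order. A second maximal N has two distinct
ones, K and L; if both lay in M, then M ⊓ N would contain K ⊔ L > K, forcing M = N. So N supplies
one outside M. -/
theorem succ_lt_ncard_card_eq_pow (hp : p.Prime) (hodd : Odd p) {m : ℕ}
    (hcard : Nat.card G = p ^ (m + 3))
    (hG : ∀ M : Subgroup G, Nat.card M = p ^ (m + 2) → ¬ IsCyclic M) :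
    p + 1 < {H : Subgroup G | Nat.card H = p ^ (m + 1)}.ncard := by
  have := Fact.mk hp
  have : Finite G := Nat.finite_of_card_ne_zero (by rw [hcard]; exact (pow_pos hp.pos _).ne')
  have hGc : ¬ IsCyclic G := by
    intro hc
    obtain ⟨M, hM⟩ := Sylow.exists_subgroup_card_pow_prime p
      (hcard ▸ pow_dvd_pow p (Nat.le_succ (m + 2)))
    exact hG M hM inferInstance
  have hsub (M : Subgroup G) (hM : Nat.card M = p ^ (m + 2)) :
      p + 1 ≤ {H : Subgroup G | H ≤ M ∧ Nat.card H = p ^ (m + 1)}.ncard := by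
    rw [Subgroup.ncard_le_and_card_eq]
    exact succ_le_ncard_card_eq_pow hp hodd m 0 hM (hG M hM)
  have h2 := hp.two_le
  obtain ⟨M, hM, N, hN, hMN⟩ := Set.one_lt_ncard_iff_nontrivial.1
    ((show 1 < p + 1 by omega).trans_le
      (succ_le_ncard_index_eq_prime (Nat.succ_ne_zero _) hcard hGc))
  rw [Set.mem_ofPred_eq] at hM hN
  obtain ⟨K, hK, L, hL, hKL⟩ := Set.one_lt_ncard_iff_nontrivial.1
    ((show 1 < p + 1 by omega).trans_le (hsub N hN))
  obtain ⟨J, hJN, hJ, hJM⟩ : ∃ J ≤ N, Nat.card J = p ^ (m + 1) ∧ ¬ J ≤ M := by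
    by_contra! hall
    have hKM := hall K hK.1 hK.2
    have hLM := hall L hL.1 hL.2
    have hlt : K < K ⊔ L := lt_of_le_of_ne le_sup_left fun heq => hKL
      (Subgroup.eq_of_le_of_card_ge (sup_eq_left.1 heq.symm) (by rw [hK.2, hL.2])).symm
    have hinf : M ⊓ N = M := by
      refine Subgroup.eq_of_le_of_card_ge inf_le_left ?_
      obtain ⟨k, hk, hMNk⟩ := (Nat.dvd_prime_pow hp).1
        (hM ▸ Subgroup.card_dvd_of_le (inf_le_left : M ⊓ N ≤ M))
      rw [hM, hMNk]
      refine Nat.pow_le_pow_right hp.pos ?_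
      by_contra hlt'
      have hle : K ⊔ L ≤ M ⊓ N := sup_le (le_inf hKM hK.1) (le_inf hLM hL.1)
      have hKeq : K = M ⊓ N := Subgroup.eq_of_le_of_card_ge (hlt.le.trans hle) (by
        rw [hMNk, hK.2]; exact Nat.pow_le_pow_right hp.pos (by omega))
      exact (hlt.trans_le hle).ne hKeq
    exact hMN (Subgroup.eq_of_le_of_card_ge (inf_eq_left.1 hinf) (by rw [hM, hN]))
  refine (hsub M hM).trans_lt (Set.ncard_lt_ncard ⟨fun H hH => hH.2, fun hss => ?_⟩)
  exact hJM (hss hJ).1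

open Finset in
theorem card_subgroup_eq_sum (hp : p.Prime) {l : ℕ} (hcard : Nat.card G = p ^ l) :
    Nat.card (Subgroup G) =
      ∑ k ∈ range (l + 1), {H : Subgroup G | Nat.card H = p ^ k}.ncard := by
  classical
  have : Finite G := Nat.finite_of_card_ne_zero (by rw [hcard]; exact (pow_pos hp.pos _).ne')
  have := Fintype.ofFinite (Subgroup G)
  have hmaps : ((univ : Finset (Subgroup G)) : Set (Subgroup G)).MapsTo
      (fun H : Subgroup G => Nat.card H) ((range (l + 1)).image (p ^ ·)) := by
    intro H _
    obtain ⟨k, hk, hHk⟩ := (Nat.dvd_prime_pow hp).1 (hcard ▸ H.card_subgroup_dvd_card)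
    simp only [coe_image, Set.mem_image, mem_coe, mem_range]
    exact ⟨k, by omega, hHk.symm⟩
  rw [Nat.card_eq_fintype_card, ← card_univ, card_eq_sum_card_fiberwise hmaps,
    sum_image (Nat.pow_right_injective hp.two_le).injOn]
  refine sum_congr rfl fun k _ => ?_
  rw [← Set.ncard_coe_finset]
  simp

theorem sum_le_card_subgroup (hp : p.Prime) {m : ℕ} (hcard : Nat.card G = p ^ (m + 1)) :
    ∑ k ∈ Finset.range m, {H : Subgroup G | Nat.card H = p ^ (k + 1)}.ncard + 2 ≤
      Nat.card (Subgroup G) := by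
  have : Finite G := Nat.finite_of_card_ne_zero (by rw [hcard]; exact (pow_pos hp.pos _).ne')
  rw [card_subgroup_eq_sum hp hcard, Finset.sum_range_succ, Finset.sum_range_succ']
  have h1 : 0 < {H : Subgroup G | Nat.card H = p ^ 0}.ncard :=
    (Set.ncard_pos).2 ⟨⊥, by simp⟩
  have h2 : 0 < {H : Subgroup G | Nat.card H = p ^ (m + 1)}.ncard :=
    (Set.ncard_pos).2 ⟨⊤, by simp [hcard]⟩
  omega

theorem le_card_subgroup (hp : p.Prime) (hodd : Odd p) {m : ℕ}
    (hcard : Nat.card G = p ^ (m + 1)) (hG : ¬ IsCyclic G) :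
    (p + 1) * m + 2 ≤ Nat.card (Subgroup G) := by
  refine le_trans (Nat.add_le_add_right ?_ 2) (sum_le_card_subgroup hp hcard)
  rw [mul_comm]
  refine (Finset.card_nsmul_le_sum _ _ (p + 1) fun k hk => ?_).trans' (by simp)
  obtain ⟨n, rfl⟩ := Nat.exists_eq_add_of_lt (Finset.mem_range.1 hk)
  exact succ_le_ncard_card_eq_pow hp hodd k n hcard hG

theorem exists_orderOf_eq_of_card_subgroup_le (hp : p.Prime) (hodd : Odd p) {m : ℕ} (hm : m ≠ 0)
    (hcard : Nat.card G = p ^ (m + 1)) (hG : ¬ IsCyclic G)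
    (hle : Nat.card (Subgroup G) ≤ (p + 1) * m + 2) : ∃ a : G, orderOf a = p ^ m := by
  have := Fact.mk hp
  have : Finite G := Nat.finite_of_card_ne_zero (by rw [hcard]; exact (pow_pos hp.pos _).ne')
  suffices ∃ M : Subgroup G, Nat.card M = p ^ m ∧ IsCyclic M by
    obtain ⟨M, hM, hMc⟩ := this
    obtain ⟨a, rfl⟩ := (Subgroup.isCyclic_iff_exists_zpowers_eq_top M).1 hMc
    exact ⟨a, (Nat.card_zpowers a).symm.trans hM⟩
  obtain ⟨n, rfl⟩ := Nat.exists_eq_succ_of_ne_zero hm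
  cases n with
  | zero =>
    obtain ⟨M, hM⟩ := Sylow.exists_subgroup_card_pow_prime p
      (hcard ▸ pow_dvd_pow p (Nat.le_succ 1))
    exact ⟨M, hM, isCyclic_of_prime_card (hM.trans (pow_one p))⟩
  | succ n =>
    by_contra! hall
    have hlt := succ_lt_ncard_card_eq_pow hp hodd hcard hall
    have hsum : ∑ _k ∈ Finset.range (n + 2), (p + 1) <
        ∑ k ∈ Finset.range (n + 2), {H : Subgroup G | Nat.card H = p ^ (k + 1)}.ncard := by
      refine Finset.sum_lt_sum (fun k hk => ?_) ⟨n, by simp, hlt⟩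
      obtain ⟨i, hi⟩ := Nat.exists_eq_add_of_lt (Finset.mem_range.1 hk)
      exact succ_le_ncard_card_eq_pow hp hodd k i (by rw [hcard]; congr 1; omega) hG
    have := sum_le_card_subgroup (m := n + 2) hp hcard
    change _ ≤ (p + 1) * (n + 2) + 2 at hle
    simp only [Finset.sum_const, Finset.card_range, smul_eq_mul] at hsum
    rw [mul_comm] at hsum
    omega

end LowerBound

/-! ### Bounding the order of the presented group. -/

section Metacyclic

variable {G : Type*} [Group G] {a b : G} {r : ℤ}

theorem exists_eq_zpow_mul_zpow_of_closure_eq_top (hb : IsOfFinOrder b)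
    (h : b⁻¹ * a * b = a ^ r) (htop : Subgroup.closure {a, b} = ⊤) (g : G) :
    ∃ n i : ℤ, g = b ^ n * a ^ i := by
  have hg : g ∈ Subgroup.closure {a, b} := htop ▸ Subgroup.mem_top g
  induction hg using Subgroup.closure_induction_right with
  | one => exact ⟨0, 0, by simp⟩
  | mul_right x _ y hy ih =>
    obtain ⟨n, i, rfl⟩ := ih
    rcases hy with rfl | rfl
    · exact ⟨n, i + 1, by rw [zpow_add_one, mul_assoc]⟩
    · exact ⟨n + 1, r * i, by
        rw [mul_assoc, zpow_mul_of_conj_eq_zpow h, ← mul_assoc, zpow_add_one]⟩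
  | mul_inv_cancel x _ y hy ih =>
    obtain ⟨n, i, rfl⟩ := ih
    rcases hy with rfl | rfl
    · exact ⟨n, i - 1, by rw [zpow_sub_one, mul_assoc]⟩
    -- The relation moves a only past positive powers of b, so the inverse is rewritten as one.
    · obtain ⟨k, hk⟩ : ∃ k : ℕ, y⁻¹ = y ^ k :=
        (hb.mem_powers_iff_mem_zpowers.2 (inv_mem (Subgroup.mem_zpowers y))).imp fun _ => Eq.symm
      exact ⟨n + k, r ^ k * i, by
        rw [hk, mul_assoc, zpow_mul_of_conj_eq_zpow (pow_conj_eq_zpow h k), ← mul_assoc, zpow_add,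
          zpow_natCast]⟩

theorem finite_and_card_le_of_closure_eq_top (ha : IsOfFinOrder a) (hb : IsOfFinOrder b)
    (h : b⁻¹ * a * b = a ^ r) (htop : Subgroup.closure {a, b} = ⊤) :
    Finite G ∧ Nat.card G ≤ orderOf b * orderOf a := by
  have hsurj : Function.Surjective
      fun x : Subgroup.zpowers b × Subgroup.zpowers a => (x.1 : G) * x.2 := by
    intro g
    obtain ⟨n, i, rfl⟩ := exists_eq_zpow_mul_zpow_of_closure_eq_top hb h htop g
    exact ⟨(⟨b ^ n, n, rfl⟩, ⟨a ^ i, i, rfl⟩), rfl⟩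
  have : Finite (Subgroup.zpowers a) := finite_zpowers.2 ha
  have : Finite (Subgroup.zpowers b) := finite_zpowers.2 hb
  refine ⟨Finite.of_surjective _ hsurj, (Nat.card_le_card_of_surjective _ hsurj).trans ?_⟩
  rw [Nat.card_prod, Nat.card_zpowers, Nat.card_zpowers]

end Metacyclic

namespace ModularGroup

variable {p m : ℕ}

theorem of_zero_pow : (PresentedGroup.of 0 : ModularGroup p (m + 1)) ^ p ^ m = 1 :=
  PresentedGroup.one_of_mem (rels := modularRels p (m + 1)) (.inl rfl)

theorem of_one_pow : (PresentedGroup.of 1 : ModularGroup p (m + 1)) ^ p = 1 :=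
  PresentedGroup.one_of_mem (rels := modularRels p (m + 1)) (.inr (.inl rfl))

theorem conj_of_zero : (PresentedGroup.of 1 : ModularGroup p (m + 1))⁻¹ * PresentedGroup.of 0 *
    PresentedGroup.of 1 = PresentedGroup.of 0 ^ ((1 + p ^ (m - 1) : ℕ) : ℤ) := by
  rw [zpow_natCast]
  exact mul_inv_eq_one.1
    (PresentedGroup.one_of_mem (rels := modularRels p (m + 1)) (.inr (.inr rfl)))

theorem closure_eq_top : Subgroup.closure
    {(PresentedGroup.of 0 : ModularGroup p (m + 1)), PresentedGroup.of 1} = ⊤ := by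
  rw [← PresentedGroup.closure_range_of]
  congr 1
  ext x
  simp [Fin.exists_fin_two, eq_comm]

theorem finite_and_card_le (hp : p ≠ 0) : Finite (ModularGroup p (m + 1)) ∧
    Nat.card (ModularGroup p (m + 1)) ≤
      p * orderOf (PresentedGroup.of 0 : ModularGroup p (m + 1)) := by
  obtain ⟨hfin, hle⟩ := finite_and_card_le_of_closure_eq_top
    (isOfFinOrder_iff_pow_eq_one.2 ⟨p ^ m, pow_pos (Nat.pos_of_ne_zero hp) m, of_zero_pow⟩)
    (isOfFinOrder_iff_pow_eq_one.2 ⟨p, Nat.pos_of_ne_zero hp, of_one_pow⟩)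
    (conj_of_zero (p := p) (m := m)) closure_eq_top
  exact ⟨hfin, hle.trans (Nat.mul_le_mul_right _
    (orderOf_le_of_pow_eq_one (Nat.pos_of_ne_zero hp) of_one_pow))⟩

theorem card_le (hp : p ≠ 0) : Nat.card (ModularGroup p (m + 1)) ≤ p ^ (m + 1) := by
  rw [pow_succ']
  exact (finite_and_card_le hp).2.trans (Nat.mul_le_mul_left _
    (orderOf_le_of_pow_eq_one (pow_pos (Nat.pos_of_ne_zero hp) m) of_zero_pow))

/-- The order is at most p · `orderOf a`, so full order leaves no room for a smaller `orderOf a`.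
For m = 1 and p prime, a^b = a² kills a and the hypothesis fails. -/
theorem orderOf_of_zero (hp : p ≠ 0) (hcard : Nat.card (ModularGroup p (m + 1)) = p ^ (m + 1)) :
    orderOf (PresentedGroup.of 0 : ModularGroup p (m + 1)) = p ^ m := by
  refine le_antisymm
    (orderOf_le_of_pow_eq_one (pow_pos (Nat.pos_of_ne_zero hp) m) of_zero_pow) ?_
  have := (finite_and_card_le (m := m) hp).2
  rw [hcard, pow_succ'] at this
  exact Nat.le_of_mul_le_mul_left this (Nat.pos_of_ne_zero hp)

end ModularGroup

/-! ### Identifying the isomorphism type. -/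

theorem CyclicGroup.exists_monoidHom_range_eq {G : Type*} [Group G] {n : ℕ} {g : G}
    (hg : g ^ n = 1) : ∃ f : CyclicGroup n →* G, f.range = Subgroup.zpowers g := by
  have hgen : ∀ x : CyclicGroup n, x ∈ Subgroup.zpowers (Multiplicative.ofAdd (1 : ZMod n)) := by
    intro x
    obtain ⟨k, hk⟩ := ZMod.intCast_surjective x.toAdd
    refine ⟨k, ?_⟩
    simp only [← ofAdd_zsmul, zsmul_one, hk, ofAdd_toAdd]
  have hord : orderOf g ∣ orderOf (Multiplicative.ofAdd (1 : ZMod n)) := by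
    rw [orderOf_ofAdd_eq_addOrderOf, ZMod.addOrderOf_one]
    exact orderOf_dvd_of_pow_eq_one hg
  refine ⟨monoidHomOfForallMemZpowers hgen hord, ?_⟩
  rw [MonoidHom.range_eq_map, ← (Subgroup.eq_top_iff' _).2 hgen, MonoidHom.map_zpowers,
    monoidHomOfForallMemZpowers_apply_gen]

namespace IsSplitMetacyclic

variable {G : Type*} [Group G] {p m : ℕ} {a b : G} {r : ℤ}

theorem nonempty_mulEquiv_prod (h : IsSplitMetacyclic p m a b r) (hp : p.Prime)
    (hr : (p : ℤ) ^ m ∣ r - 1) : Nonempty (G ≃* CyclicGroup (p ^ m) × CyclicGroup p) := by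
  have hcomm : Commute a b := by
    have h1 : a ^ r = a ^ (1 : ℤ) := by
      rw [zpow_eq_zpow_iff_modEq, h.orderOf_eq]
      exact (Int.modEq_iff_dvd.2 (by exact_mod_cast hr)).symm
    have h2 := h.conj_eq
    rw [h1, zpow_one, mul_assoc, inv_mul_eq_iff_eq_mul] at h2
    exact h2
  obtain ⟨f, hf⟩ := CyclicGroup.exists_monoidHom_range_eq (h.orderOf_eq ▸ pow_orderOf_eq_one a)
  obtain ⟨f', hf'⟩ := CyclicGroup.exists_monoidHom_range_eq h.pow_eq
  have hff' : ∀ x y, Commute (f x) (f' y) := by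
    intro x y
    obtain ⟨i, hi⟩ : f x ∈ Subgroup.zpowers a := hf ▸ ⟨x, rfl⟩
    obtain ⟨j, hj⟩ : f' y ∈ Subgroup.zpowers b := hf' ▸ ⟨y, rfl⟩
    rw [← hi, ← hj]
    exact hcomm.zpow_zpow i j
  have hsurj : Function.Surjective (f.noncommCoprod f' hff') := by
    intro g
    obtain ⟨n, i, rfl⟩ := h.exists_eq_zpow_mul_zpow hp g
    obtain ⟨x, hx⟩ : a ^ i ∈ f.range := hf ▸ Subgroup.zpow_mem_zpowers a i
    obtain ⟨y, hy⟩ : b ^ n ∈ f'.range := hf' ▸ Subgroup.zpow_mem_zpowers b n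
    exact ⟨(x, y), by rw [MonoidHom.noncommCoprod_apply', hx, hy]⟩
  have : NeZero p := ⟨hp.ne_zero⟩
  have hc : Nat.card (CyclicGroup (p ^ m) × CyclicGroup p) = Nat.card G := by
    rw [Nat.card_prod, h.card_eq, pow_succ]
    congr 1 <;> exact Nat.card_zmod _
  have : Finite (CyclicGroup (p ^ m) × CyclicGroup p) := Nat.finite_of_card_ne_zero (by
    rw [hc, h.card_eq]; exact (pow_pos hp.pos _).ne')
  exact ⟨(MulEquiv.ofBijective _ (hsurj.bijective_of_nat_card_le hc.le)).symm⟩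

/-- From p^m ∣ r^p - 1 = (r - 1)pu comes r = 1 + p^(m-1)t, with p ∤ t since p^m ∤ r - 1. If st ≡ 1
modulo p, replacing b by b^s turns the exponent into 1 + p^(m-1). -/
theorem nonempty_mulEquiv_modularGroup (h : IsSplitMetacyclic p m a b r) (hp : p.Prime)
    (hodd : Odd p) (hm : m ≠ 0) (hr : ¬ (p : ℤ) ^ m ∣ r - 1) :
    Nonempty (G ≃* ModularGroup p (m + 1)) := by
  have hp' := Nat.prime_iff_prime_int.1 hp
  have hcomm : Commute a (b ^ p) := by rw [h.pow_eq]; exact .one_right a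
  have hpr := dvd_sub_one_of_conj_eq_zpow hp hm h.orderOf_eq hcomm h.conj_eq
  obtain ⟨n, rfl⟩ : ∃ n, m = n + 2 := by
    rcases m with _ | _ | n
    · exact (hm rfl).elim
    · exact (hr (by simpa using hpr)).elim
    · exact ⟨n, rfl⟩
  obtain ⟨u, hu, hpu⟩ := h.exists_geom_sum_eq_mul hp hodd hm
  obtain ⟨t, ht⟩ : (p : ℤ) ^ (n + 1) ∣ r - 1 := by
    have h1 := dvd_pow_sub_one_of_conj_eq_zpow h.orderOf_eq hcomm h.conj_eq
    rw [← geom_sum_mul, hu, mul_assoc, Nat.cast_pow, pow_succ',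
      mul_dvd_mul_iff_left hp'.ne_zero] at h1
    exact hpu.pow_left.dvd_of_dvd_mul_left h1
  have hpt : IsCoprime (p : ℤ) t := by
    rw [hp'.coprime_iff_not_dvd]
    rintro ⟨c, rfl⟩
    exact hr ⟨c, by rw [ht]; ring⟩
  obtain ⟨s, w, hsw⟩ : ∃ (s : ℕ) (w : ℤ), s * t + p * w = 1 := by
    obtain ⟨w, s, hws⟩ := hpt
    have hp1 : (1 : ℤ) ≤ p := by exact_mod_cast hp.pos
    -- Adding p|s| makes the inverse a natural number without changing it modulo p.
    obtain ⟨s', hs'⟩ := Int.eq_ofNat_of_zero_le (show 0 ≤ s + p * |s| by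
      nlinarith [neg_abs_le s, abs_nonneg s])
    exact ⟨s', w - |s| * t, by rw [← hs']; linear_combination hws⟩
  have hconj : (b ^ s)⁻¹ * a * b ^ s = a ^ (1 + p ^ (n + 1)) := by
    rw [pow_conj_eq_zpow h.conj_eq, ← zpow_natCast, zpow_eq_zpow_iff_modEq, h.orderOf_eq]
    refine (Int.modEq_iff_dvd.2 ?_).symm
    obtain ⟨c, hc⟩ := sq_dvd_add_pow_sub_sub ((p : ℤ) ^ (n + 1) * t) 1 s
    have hr1 : r = 1 + (p : ℤ) ^ (n + 1) * t := by linarith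
    rw [← hr1, one_pow, one_pow] at hc
    push_cast
    exact ⟨p ^ n * t ^ 2 * c - w, by linear_combination hc + (p : ℤ) ^ (n + 1) * hsw⟩
  let f : ModularGroup p (n + 2 + 1) →* G := PresentedGroup.toGroup (f := ![a, b ^ s]) (by
    rintro _ (rfl | rfl | rfl)
    · simp [← h.orderOf_eq, pow_orderOf_eq_one]
    · simp [pow_right_comm b s p, h.pow_eq]
    · simpa [mul_inv_eq_one] using hconj)
  have hfa : a ∈ f.range := ⟨PresentedGroup.of 0, PresentedGroup.toGroup.of _⟩
  have hfb : b ∈ f.range := by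
    have h1 : b ^ s ∈ f.range := ⟨PresentedGroup.of 1, PresentedGroup.toGroup.of _⟩
    have h2 : b = (b ^ s) ^ t := by
      rw [← zpow_natCast, ← zpow_mul, eq_sub_of_add_eq hsw, zpow_sub, zpow_one, zpow_mul,
        zpow_natCast, h.pow_eq, one_zpow, inv_one, mul_one]
    rw [h2]
    exact zpow_mem h1 t
  have hsurj : Function.Surjective f := by
    intro g
    obtain ⟨k, i, rfl⟩ := h.exists_eq_zpow_mul_zpow hp g
    exact mul_mem (zpow_mem hfb k) (zpow_mem hfa i)
  have := (ModularGroup.finite_and_card_le (m := n + 2) hp.ne_zero).1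
  exact ⟨(MulEquiv.ofBijective f (hsurj.bijective_of_nat_card_le
    (h.card_eq ▸ ModularGroup.card_le hp.ne_zero))).symm⟩

end IsSplitMetacyclic

theorem theoremA (p l : ℕ) (hp : p.Prime) (hodd : Odd p)
    (G : Type*) [Group G] (hcard : Nat.card G = p ^ l) (hG : ¬ IsCyclic G) :
    (p + 1) * (l - 1) + 2 ≤ Nat.card (Subgroup G) ∧
    (Nat.card (Subgroup G) = (p + 1) * (l - 1) + 2 ↔
      Nonempty (G ≃* CyclicGroup (p ^ (l - 1)) × CyclicGroup p) ∨
      Nonempty (G ≃* ModularGroup p l)) := by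
  have := Fact.mk hp
  obtain ⟨m, hm, rfl⟩ : ∃ m ≠ 0, l = m + 1 := by
    rcases l with _ | _ | m
    · have : Subsingleton G := (Nat.card_eq_one_iff_unique.1 (by simpa using hcard)).1
      exact (hG inferInstance).elim
    · exact (hG (isCyclic_of_prime_card (p := p) (by simpa using hcard))).elim
    · exact ⟨m + 1, m.succ_ne_zero, rfl⟩
  rw [Nat.add_sub_cancel]
  have hle := le_card_subgroup hp hodd hcard hG
  refine ⟨hle, fun heq => ?_, fun hiso => le_antisymm ?_ hle⟩
  · obtain ⟨a, ha⟩ := exists_orderOf_eq_of_card_subgroup_le hp hodd hm hcard hG heq.le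
    obtain ⟨b, r, h⟩ := exists_isSplitMetacyclic hp hodd hm hcard hG ha
    by_cases hr : (p : ℤ) ^ m ∣ r - 1
    · exact .inl (h.nonempty_mulEquiv_prod hp hr)
    · exact .inr (h.nonempty_mulEquiv_modularGroup hp hodd hm hr)
  -- An element of order p^m is all the upper bound needs. In the modular case the order of the
  -- presented group is read off from |G|.
  · obtain ⟨a, ha⟩ : ∃ a : G, orderOf a = p ^ m := by
      rcases hiso with ⟨⟨e⟩⟩ | ⟨⟨e⟩⟩
      · refine ⟨e.symm (Multiplicative.ofAdd 1, 1), ?_⟩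
        rw [MulEquiv.orderOf_eq, Prod.orderOf_mk, orderOf_one, Nat.lcm_one_right,
          orderOf_ofAdd_eq_addOrderOf, ZMod.addOrderOf_one]
      · refine ⟨e.symm (PresentedGroup.of 0), ?_⟩
        rw [MulEquiv.orderOf_eq]
        exact ModularGroup.orderOf_of_zero hp.ne_zero
          ((Nat.card_congr e.toEquiv).symm.trans hcard)
    obtain ⟨b, r, h⟩ := exists_isSplitMetacyclic hp hodd hm hcard hG ha
    exact h.card_subgroup_le hp hodd hm
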